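/- Let $p$ be a prime, let $R$ be a ring and let $M$ be a contravariant functor from the category of finite $p$-groups and group homomorphisms to the category of $R$-modules. Extend $M$ to pro-$p$ groups and continuous homomorphisms by $M(G)=\varinjlim_N M(G/N)$, where $N$ runs through the open normal subgroups of $G$; write $f^*=M(f)$. Let $(\mathcal F_i)_{i\in I}$ be an inverse system, indexed by a non-empty directed set $I$, of fusion systems $\mathcal F_i$ on finite $p$-groups $S_i$; that is, the $S_i$ form an inverse system of groups with homomorphisms $f_{i,j}\colon S_j\to S_i$ for $i\le j$, and for each $\varphi\in\operatorname{Hom}_{\mathcal F_j}(P,Q)$ there is a $\psi\in \operatorname{Hom}_{\mathcal F_i}(f_{i,j}(P),f_{i,j}(Q))$ with $\psi f_{i,j}|_P=f_{i,j}\varphi$. Let $S=\varprojlim S_i$ be its limit, a pro-$p$ group, with projections $f_i\colon S\to S_i$, and let $\mathcal F=\varprojlim\mathcal F_i$ be the resulting pro-fusion system on $S$: its objects are the closed subgroups of $S$ and $\operatorname{Hom}_{\mathcal F}(P,Q)=\varprojlim_i\operatorname{Hom}_{\mathcal F_i}(f_i(P),f_i(Q))$, regarded as a set of continuous homomorphisms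 $P\to Q$. Suppose that $\mathcal F$ is pro-saturated, i.e. that it is the inverse limit of some inverse system, indexed by a non-empty directed set, of saturated fusion systems on finite $p$-groups (for example, that all the $\mathcal F_i$ are saturated). Let $M(S)^{\mathcal F}$ be the submodule of stable elements of $M(S)$: those $x\in M(S)$ such that $i_P^*(x)=\varphi^*(x)$ for every closed subgroup $P$ of $S$, with inclusion $i_P\colon P\to S$, and every $\varphi\in\operatorname{Hom}_{\mathcal F}(P,S)$. Define $M(S_i)^{\mathcal F_i}\subseteq M(S_i)$ in the same way. The maps $f_{i,j}^*$ restrict to maps $M(S_i)^{\mathcal F_i}\to M(S_j)^{\mathcal F_j}$ for $i\le j$. Then the inflation maps $f_i^*\colon M(S_i)\to M(S)$ induce an isomorphism of $R$-modules $$\varinjlim_{i\in I} M(S_i)^{\mathcal F_i}\;\cong\; M(S)^{\mathcal F}.$$ -/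

import Mathlib

open CategoryTheory

universe u v w t r s

set_option linter.checkUnivs false

noncomputable section

/-! ### Finite `p`-groups, pro-`p` groups and functors on them -/

/-- `G` is a finite `p`-group. -/
class IsFinPGroup (p : ℕ) (G : Type u) [Group G] : Prop where
  finite : Finite G
  isPGroup : IsPGroup p G

/-- The category of finite `p`-groups and group homomorphisms. -/
abbrev FinPGrp (p : ℕ) : Type (u + 1) :=
  ObjectProperty.FullSubcategory (fun G : GrpCat.{u} => IsFinPGroup p G)

/-- A finite `p`-group as an object of the category of finite `p`-groups. -/
abbrev FinPGrp.of (p : ℕ) (G : Type u) [Group G] [h : IsFinPGroup p G] : FinPGrp.{u} p :=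
  ⟨GrpCat.of G, h⟩

instance IsFinPGroup.subgroup {p : ℕ} {G : Type u} [Group G] [h : IsFinPGroup p G]
    (P : Subgroup G) : IsFinPGroup p P where
  finite := by
    have := h.finite
    infer_instance
  isPGroup := h.isPGroup.to_subgroup P

/-- A contravariant functor from finite `p`-groups to `R`-modules. -/
abbrev PGroupFunctor (p : ℕ) (R : Type v) [Ring R] :=
  (FinPGrp.{u} p)ᵒᵖ ⥤ ModuleCat.{w} R

namespace PGroupFunctor

variable {p : ℕ} {R : Type v} [Ring R] (M : PGroupFunctor.{u, v, w} p R)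

/-- The value `M(G)` on a finite `p`-group `G`. -/
abbrev val (G : Type u) [Group G] [IsFinPGroup p G] : Type w :=
  M.obj (Opposite.op (FinPGrp.of p G))

/-- The map `φ^* : M(H) → M(G)` for a homomorphism `φ : G → H` of finite `p`-groups. -/
def pull {G H : Type u} [Group G] [Group H] [IsFinPGroup p G] [IsFinPGroup p H] (φ : G →* H) :
    M.val H →ₗ[R] M.val G :=
  (M.map (Quiver.Hom.op (ObjectProperty.homMk (GrpCat.ofHom φ) :
    FinPGrp.of p G ⟶ FinPGrp.of p H))).hom

theorem pull_id {G : Type u} [Group G] [IsFinPGroup p G] (x : M.val G) :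
    M.pull (MonoidHom.id G) x = x := by
  have h := M.map_id (Opposite.op (FinPGrp.of p G))
  exact congrArg (fun f => f.hom x) h

theorem pull_comp {G H K : Type u} [Group G] [Group H] [Group K] [IsFinPGroup p G]
    [IsFinPGroup p H] [IsFinPGroup p K] (ψ : H →* K) (φ : G →* H) (x : M.val K) :
    M.pull (ψ.comp φ) x = M.pull φ (M.pull ψ x) := by
  have h := M.map_comp
    (Quiver.Hom.op (ObjectProperty.homMk (GrpCat.ofHom ψ) : FinPGrp.of p H ⟶ FinPGrp.of p K))
    (Quiver.Hom.op (ObjectProperty.homMk (GrpCat.ofHom φ) : FinPGrp.of p G ⟶ FinPGrp.of p H))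
  exact congrArg (fun f => f.hom x) h

end PGroupFunctor

/-- `G` is a pro-`p` group: a profinite group all of whose finite continuous quotients are
`p`-groups. -/
class IsProPGroup (p : ℕ) (G : Type u) [Group G] [TopologicalSpace G] : Prop extends
    IsTopologicalGroup G, CompactSpace G, T2Space G, TotallyDisconnectedSpace G where
  isPGroup_quotient : ∀ N : OpenNormalSubgroup G, IsPGroup p (G ⧸ N.toSubgroup)

instance IsProPGroup.quotient {p : ℕ} {G : Type u} [Group G] [TopologicalSpace G]
    [h : IsProPGroup p G] (N : OpenNormalSubgroup G) : IsFinPGroup p (G ⧸ N.toSubgroup) where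
  finite := Subgroup.quotient_finite_of_isOpen N.toSubgroup N.isOpen'
  isPGroup := h.isPGroup_quotient N

/-- A closed subgroup of a pro-`p` group is a pro-`p` group. -/
instance IsProPGroup.closedSubgroup {p : ℕ} {G : Type u} [Group G] [TopologicalSpace G]
    [h : IsProPGroup p G] (P : ClosedSubgroup G) : IsProPGroup p P where
  toIsTopologicalGroup := inferInstanceAs (IsTopologicalGroup P.toSubgroup)
  toCompactSpace := inferInstance
  toT2Space := inferInstance
  toTotallyDisconnectedSpace := inferInstanceAs (TotallyDisconnectedSpace (P : Set G))
  isPGroup_quotient N := by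
    obtain ⟨U, hU, hUN⟩ := isOpen_induced_iff.mp N.isOpen'
    have h1 : (1 : G) ∈ U := by
      have : (1 : P) ∈ (Subtype.val ⁻¹' U : Set P) := by
        rw [hUN]
        exact N.one_mem'
      exact this
    obtain ⟨K, hK⟩ := ProfiniteGrp.exist_openNormalSubgroup_sub_open_nhds_of_one hU h1
    intro x
    induction x using QuotientGroup.induction_on with
    | H a =>
      obtain ⟨k, hk⟩ := h.isPGroup_quotient K (QuotientGroup.mk (a : G))
      refine ⟨k, ?_⟩
      rw [← QuotientGroup.mk_pow, QuotientGroup.eq_one_iff] at hk ⊢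
      have hm : (a ^ p ^ k : P) ∈ (Subtype.val ⁻¹' U : Set P) := hK hk
      rw [hUN] at hm
      exact hm

namespace PGroupFunctor

variable {p : ℕ} {R : Type v} [Ring R] (M : PGroupFunctor.{u, v, w} p R)

section Extension

variable (G : Type u) [Group G] [TopologicalSpace G] [IsProPGroup p G]

variable {G} in
/-- The quotient map `G/K → G/N` for open normal subgroups `K ≤ N` of `G`. -/
def quotientProj {N K : OpenNormalSubgroup G} (h : K ≤ N) :
    G ⧸ K.toSubgroup →* G ⧸ N.toSubgroup :=
  QuotientGroup.map K.toSubgroup N.toSubgroup (MonoidHom.id G) (fun _ hx => h hx)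

/-- The transition maps `M(G/N) → M(G/K)` for open normal subgroups `K ≤ N` of `G`. -/
def quotientTransition (N K : (OpenNormalSubgroup G)ᵒᵈ) (h : N ≤ K) :
    M.val (G ⧸ (OrderDual.ofDual N).toSubgroup) →ₗ[R]
      M.val (G ⧸ (OrderDual.ofDual K).toSubgroup) :=
  M.pull (quotientProj (N := OrderDual.ofDual N) (K := OrderDual.ofDual K) h)

open Classical in
/-- The extension of `M` to pro-`p` groups: `M(G)` is the direct limit of the `M(G/N)`, where `N`
runs through the open normal subgroups of `G`, ordered by reverse inclusion. -/
abbrev ext : Type (max u w) :=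
  Module.DirectLimit (R := R) (ι := (OpenNormalSubgroup G)ᵒᵈ)
    (fun N => M.val (G ⧸ (OrderDual.ofDual N).toSubgroup)) (M.quotientTransition G)

variable {G}

open Classical in
/-- The canonical map `M(G/N) → M(G)`. -/
def toExt (N : OpenNormalSubgroup G) : M.val (G ⧸ N.toSubgroup) →ₗ[R] M.ext G :=
  Module.DirectLimit.of R (OpenNormalSubgroup G)ᵒᵈ
    (fun N => M.val (G ⧸ (OrderDual.ofDual N).toSubgroup)) (M.quotientTransition G)
    (OrderDual.toDual N)

theorem toExt_transition (N K : OpenNormalSubgroup G) (h : K ≤ N) (x : M.val (G ⧸ N.toSubgroup)) :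
    M.toExt K (M.pull (quotientProj h) x) = M.toExt N x := by
  classical
  exact Module.DirectLimit.of_f (f := M.quotientTransition G) (i := OrderDual.toDual N)
    (j := OrderDual.toDual K) (hij := h)

/-- The kernel of a homomorphism, as an open normal subgroup when it is open. -/
def kerOpenNormal {A : Type u} [Group A] (π : G →* A) (hπ : IsOpen (π.ker : Set G)) :
    OpenNormalSubgroup G where
  toSubgroup := π.ker
  isOpen' := hπ

/-- The homomorphism `G/K → A` induced by `π : G → A` with open kernel `K`. -/
def kerQuotientMap {A : Type u} [Group A] (π : G →* A) (hπ : IsOpen (π.ker : Set G)) :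
    G ⧸ (kerOpenNormal π hπ).toSubgroup →* A :=
  QuotientGroup.kerLift π

/-- Inflation `M(A) → M(G)` along a homomorphism from a pro-`p` group `G` to a finite
`p`-group `A` with open kernel `K`, i.e. continuous for the discrete topology on `A`: the map
`M(A) → M(G/K)` induced by `π`, followed by the canonical map to `M(G)`. -/
def inflation {A : Type u} [Group A] [IsFinPGroup p A] (π : G →* A)
    (hπ : IsOpen (π.ker : Set G)) : M.val A →ₗ[R] M.ext G :=
  (M.toExt (kerOpenNormal π hπ)).comp (M.pull (kerQuotientMap π hπ))

variable {H : Type u} [Group H] [TopologicalSpace H] [IsProPGroup p H]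

/-- The inverse image of an open normal subgroup under a continuous homomorphism. -/
def comapOpenNormal (φ : G →ₜ* H) (N : OpenNormalSubgroup H) : OpenNormalSubgroup G where
  toSubgroup := N.toSubgroup.comap φ.toMonoidHom
  isOpen' := N.isOpen'.preimage φ.continuous_toFun

/-- The map `G/φ⁻¹(N) → H/N` induced by `φ : G → H`. -/
def quotientMap (φ : G →ₜ* H) (N : OpenNormalSubgroup H) :
    G ⧸ (comapOpenNormal φ N).toSubgroup →* H ⧸ N.toSubgroup :=
  QuotientGroup.map _ _ φ.toMonoidHom le_rfl

open Classical in
/-- The map `φ^* : M(H) → M(G)` for a continuous homomorphism `φ : G → H` of pro-`p` groups: on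
`M(H/N)` it is the map to `M(G/φ⁻¹(N))` induced by `φ`, followed by the canonical map to `M(G)`. -/
def extPull (φ : G →ₜ* H) : M.ext H →ₗ[R] M.ext G :=
  Module.DirectLimit.lift R (OpenNormalSubgroup H)ᵒᵈ
    (fun N => M.val (H ⧸ (OrderDual.ofDual N).toSubgroup)) (M.quotientTransition H)
    (fun N => (M.toExt (comapOpenNormal φ (OrderDual.ofDual N))).comp
      (M.pull (quotientMap φ (OrderDual.ofDual N))))
    (by
      intro N K h x
      have hle : comapOpenNormal φ (OrderDual.ofDual K) ≤ comapOpenNormal φ (OrderDual.ofDual N) :=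
        fun y hy => h hy
      rw [LinearMap.comp_apply, LinearMap.comp_apply,
        ← M.toExt_transition (comapOpenNormal φ (OrderDual.ofDual N))
          (comapOpenNormal φ (OrderDual.ofDual K)) hle,
        quotientTransition, ← M.pull_comp, ← M.pull_comp]
      have e : (quotientMap φ (OrderDual.ofDual N)).comp
          (quotientProj hle) = (quotientProj (N := OrderDual.ofDual N) (K := OrderDual.ofDual K)
            h).comp (quotientMap φ (OrderDual.ofDual K)) := by
        ext y
        rfl
      rw [e])

theorem extPull_toExt (φ : G →ₜ* H) (N : OpenNormalSubgroup H) (x : M.val (H ⧸ N.toSubgroup)) :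
    M.extPull φ (M.toExt N x) = M.toExt (comapOpenNormal φ N) (M.pull (quotientMap φ N) x) := by
  classical
  exact Module.DirectLimit.lift_of (f := M.quotientTransition H) (i := OrderDual.toDual N) _ _ x

end Extension

end PGroupFunctor

/-! ### Fusion systems on finite `p`-groups -/

/-- A fusion system on a finite `p`-group `S`: a category whose objects are the subgroups of `S`
and whose morphisms are injective group homomorphisms (composed as maps), which contains all the
homomorphisms induced by conjugation in `S`, and in which each `φ : P → Q` factors as an
isomorphism of the category from `P` onto `φ(P)` followed by an inclusion. -/
structure FusionSystem (S : Type u) [Group S] where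
  /-- The set of morphisms from `P` to `Q`. -/
  Hom : ∀ P Q : Subgroup S, Set (P →* Q)
  injective : ∀ {P Q : Subgroup S} {φ : P →* Q}, φ ∈ Hom P Q → Function.Injective φ
  conj_mem : ∀ {P Q : Subgroup S} (φ : P →* Q) (g : S),
    (∀ x : P, (φ x : S) = g * x * g⁻¹) → φ ∈ Hom P Q
  comp_mem : ∀ {P Q T : Subgroup S} {ψ : Q →* T} {φ : P →* Q},
    ψ ∈ Hom Q T → φ ∈ Hom P Q → ψ.comp φ ∈ Hom P T
  iso_mem : ∀ {P Q P' : Subgroup S} {φ : P →* Q}, φ ∈ Hom P Q → ∀ e : P ≃* P',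
    (∀ x : P, (e x : S) = φ x) → e.toMonoidHom ∈ Hom P P' ∧ e.symm.toMonoidHom ∈ Hom P' P

namespace FusionSystem

variable {S : Type u} [Group S] (F : FusionSystem S)

theorem inclusion_mem {P Q : Subgroup S} (h : P ≤ Q) : Subgroup.inclusion h ∈ F.Hom P Q :=
  F.conj_mem _ 1 (fun x => by simp)

/-- `P` and `Q` are isomorphic in the fusion system. -/
def IsConj (P Q : Subgroup S) : Prop :=
  ∃ φ ∈ F.Hom P Q, Function.Surjective φ

/-- `P` is fully normalized: `|N_S(Q)| ≤ |N_S(P)|` for all `Q` isomorphic to `P` in `F`. -/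
def FullyNormalized (P : Subgroup S) : Prop :=
  ∀ Q : Subgroup S, F.IsConj P Q →
    Nat.card (Subgroup.normalizer (Q : Set S)) ≤ Nat.card (Subgroup.normalizer (P : Set S))

/-- `P` is fully centralized: `|C_S(Q)| ≤ |C_S(P)|` for all `Q` isomorphic to `P` in `F`. -/
def FullyCentralized (P : Subgroup S) : Prop :=
  ∀ Q : Subgroup S, F.IsConj P Q →
    Nat.card (Subgroup.centralizer (Q : Set S)) ≤ Nat.card (Subgroup.centralizer (P : Set S))

/-- The group `Aut_F(P)` of automorphisms of `P` in `F`. -/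
def aut (P : Subgroup S) : Subgroup (MulAut P) where
  carrier := {e | e.toMonoidHom ∈ F.Hom P P}
  one_mem' := F.conj_mem _ 1 (fun x => by simp)
  mul_mem' ha hb := F.comp_mem ha hb
  inv_mem' {a} ha := (F.iso_mem ha a (fun _ => rfl)).2

/-- The group `Aut_S(P)` of automorphisms of `P` induced by conjugation in `S`. -/
def autConj (P : Subgroup S) : Subgroup (MulAut P) :=
  P.normalizerMonoidHom.range

/-- For a morphism `φ` from `P` onto `Q`, the group `N_φ` of those `g` in `N_S(P)` for which the
automorphism `φ c_g φ⁻¹` of `Q` is conjugation by an element of `N_S(Q)`. -/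
def extender {P Q : Subgroup S} (φ : P →* Q) : Subgroup S where
  carrier := {g | g ∈ Subgroup.normalizer (P : Set S) ∧
    ∃ h ∈ Subgroup.normalizer (Q : Set S), ∀ x y : P, (y : S) = g * x * g⁻¹ →
      (φ y : S) = h * φ x * h⁻¹}
  one_mem' := ⟨one_mem _, 1, one_mem _, fun x y hxy => by
    have : y = x := Subtype.ext (by simpa using hxy)
    simp [this]⟩
  mul_mem' := by
    rintro a b ⟨ha, c, hc, hac⟩ ⟨hb, d, hd, hbd⟩
    refine ⟨mul_mem ha hb, c * d, mul_mem hc hd, fun x y hxy => ?_⟩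
    have hz : b * x * b⁻¹ ∈ P := (Subgroup.mem_normalizer_iff.mp hb x).mp x.2
    rw [hac ⟨b * x * b⁻¹, hz⟩ y (by rw [hxy]; group), hbd x ⟨b * x * b⁻¹, hz⟩ rfl]
    group
  inv_mem' := by
    rintro a ⟨ha, c, hc, hac⟩
    refine ⟨inv_mem ha, c⁻¹, inv_mem hc, fun x y hxy => ?_⟩
    rw [hac y x (by rw [hxy]; group)]
    group

theorem le_extender {P Q : Subgroup S} (φ : P →* Q) : P ≤ extender φ := fun g hg =>
  ⟨Subgroup.le_normalizer hg, φ ⟨g, hg⟩, Subgroup.le_normalizer (φ ⟨g, hg⟩).2, fun x y hxy => by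
    have : y = ⟨g, hg⟩ * x * ⟨g, hg⟩⁻¹ := Subtype.ext hxy
    simp [this]⟩

/-- A fusion system on a finite `p`-group `S` is saturated if
(I) each fully normalized `P` is fully centralized and `Aut_S(P)` is a Sylow `p`-subgroup of
`Aut_F(P)`;
(II) each morphism `φ` from `P` onto a fully centralized `Q` extends to a morphism
`N_φ → S`. -/
structure IsSaturated (p : ℕ) : Prop where
  sylow : ∀ P : Subgroup S, F.FullyNormalized P → F.FullyCentralized P ∧
    ∃ A : Sylow p (F.aut P), A.toSubgroup.map (F.aut P).subtype = autConj P
  extend : ∀ (P Q : Subgroup S) (φ : P →* Q), φ ∈ F.Hom P Q → Function.Surjective φ →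
    F.FullyCentralized Q → ∃ ψ ∈ F.Hom (extender φ) ⊤,
      ∀ x : P, (ψ ⟨x, le_extender φ x.2⟩ : S) = φ x

/-- A group homomorphism `α : S → T` underlies a morphism of fusion systems from `F` to `G`: every
`φ : P → Q` in `F` induces a morphism `ψ : α(P) → α(Q)` in `G` with `ψ α = α φ` on `P`. Such a `ψ`
is unique, so `P ↦ α(P)`, `φ ↦ ψ` is then a functor. -/
def IsMorphism {T : Type t} [Group T] (G : FusionSystem T) (α : S →* T) : Prop :=
  ∀ (P Q : Subgroup S) (φ : P →* Q), φ ∈ F.Hom P Q → ∃ ψ ∈ G.Hom (P.map α) (Q.map α),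
    ∀ x : P, (ψ ⟨α x, Subgroup.mem_map_of_mem α x.2⟩ : T) = α (φ x)

end FusionSystem

/-! ### Pro-fusion systems -/

/-- An inverse system, over a preordered set `I`, of fusion systems
`F i` on finite `p`-groups `S i`, the transition maps being morphisms of fusion systems. -/
structure FusionInverseSystem (p : ℕ) (I : Type v) [Preorder I] where
  /-- The finite `p`-groups. -/
  S : I → Type u
  [group : ∀ i, Group (S i)]
  [isFinPGroup : ∀ i, IsFinPGroup p (S i)]
  /-- The fusion systems. -/
  F : ∀ i, FusionSystem (S i)
  /-- The transition homomorphisms. -/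
  f : ∀ {i j : I}, i ≤ j → S j →* S i
  f_refl : ∀ (i : I) (x : S i), f (le_refl i) x = x
  f_trans : ∀ {i j k : I} (hij : i ≤ j) (hjk : j ≤ k) (x : S k),
    f hij (f hjk x) = f (hij.trans hjk) x
  isMorphism : ∀ {i j : I} (hij : i ≤ j), (F j).IsMorphism (F i) (f hij)

attribute [instance] FusionInverseSystem.group FusionInverseSystem.isFinPGroup

/-- The whole group as a closed subgroup. -/
instance ClosedSubgroup.instTop (S : Type u) [Group S] [TopologicalSpace S] :
    Top (ClosedSubgroup S) :=
  ⟨{ toSubgroup := ⊤, isClosed' := isClosed_univ }⟩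

/-- The inclusion of a closed subgroup, as a continuous homomorphism. -/
def ClosedSubgroup.incl {S : Type u} [Group S] [TopologicalSpace S] (P : ClosedSubgroup S) :
    P →ₜ* S where
  toMonoidHom := P.toSubgroup.subtype
  continuous_toFun := continuous_subtype_val

/-- A category whose objects are the closed subgroups of `S` and whose morphisms are continuous
homomorphisms, composed as maps. -/
structure ClosedSubgroupCategory (S : Type u) [Group S] [TopologicalSpace S] where
  /-- The set of morphisms from `P` to `Q`. -/
  Hom : ∀ P Q : ClosedSubgroup S, Set (P →ₜ* Q)
  id_mem : ∀ P : ClosedSubgroup S, ContinuousMonoidHom.id P ∈ Hom P P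
  comp_mem : ∀ {P Q T : ClosedSubgroup S} {ψ : Q →ₜ* T} {φ : P →ₜ* Q},
    ψ ∈ Hom Q T → φ ∈ Hom P Q → ψ.comp φ ∈ Hom P T

namespace ClosedSubgroupCategory

variable {S : Type u} [Group S] [TopologicalSpace S] (F : ClosedSubgroupCategory S)

/-- `F` is the inverse limit, on `S = lim S i`, of an inverse system of fusion systems on finite
`p`-groups, by way of the projections `π i : S → S i`. The projections are continuous for the
discrete topology on `S i` and make the group `S` the inverse limit of the `S i`; and
`Hom_F(P, Q)` is the inverse limit of the finite sets `Hom_{F i}(π i P, π i Q)`, which is the set of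
the `φ : P → Q` that induce on all the `π i P → π i Q` a (necessarily unique) morphism of `F i`. -/
structure IsInverseLimit {p : ℕ} {I : Type v} [Preorder I]
    (𝓕 : FusionInverseSystem.{t} p I) (π : ∀ i, S →* 𝓕.S i) : Prop where
  isOpen_ker : ∀ i, IsOpen ((π i).ker : Set S)
  compatible : ∀ {i j : I} (hij : i ≤ j) (x : S), 𝓕.f hij (π j x) = π i x
  existsUnique : ∀ s : ∀ i, 𝓕.S i, (∀ {i j : I} (hij : i ≤ j), 𝓕.f hij (s j) = s i) →
    ∃! x : S, ∀ i, π i x = s i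
  mem_hom_iff : ∀ (P Q : ClosedSubgroup S) (φ : P →ₜ* Q), φ ∈ F.Hom P Q ↔
    ∀ i, ∃ ψ ∈ (𝓕.F i).Hom (P.toSubgroup.map (π i)) (Q.toSubgroup.map (π i)),
      ∀ x : P, (ψ ⟨π i x, Subgroup.mem_map_of_mem (π i) x.2⟩ : 𝓕.S i) = π i (φ x)

/-- `F` is pro-saturated: it is the inverse limit, over some directed set, of saturated fusion
systems on finite `p`-groups. -/
def IsProSaturated (p : ℕ) : Prop :=
  ∃ (J : Type v) (_ : Preorder J) (_ : Nonempty J) (_ : IsDirectedOrder J)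
    (𝓖 : FusionInverseSystem.{t} p J) (ρ : ∀ j, S →* 𝓖.S j),
    F.IsInverseLimit 𝓖 ρ ∧ ∀ j, (𝓖.F j).IsSaturated p

end ClosedSubgroupCategory

/-! ### Stable elements -/

namespace PGroupFunctor

variable {p : ℕ} {R : Type v} [Ring R] (M : PGroupFunctor.{u, v, w} p R)

/-- The stable elements `M(S)^F` for a fusion system `F` on a finite `p`-group `S`: those `x` for
which `i_P^* x = φ^* x` for all subgroups `P` with inclusion `i_P` and all `φ ∈ Hom_F(P, S)`. -/
def finStable {S : Type u} [Group S] [IsFinPGroup p S] (F : FusionSystem S) :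
    Submodule R (M.val S) where
  carrier := {x | ∀ (P : Subgroup S) (φ : P →* (⊤ : Subgroup S)), φ ∈ F.Hom P ⊤ →
    M.pull P.subtype x = M.pull ((⊤ : Subgroup S).subtype.comp φ) x}
  zero_mem' _ _ _ := by simp
  add_mem' ha hb P φ hφ := by rw [map_add, map_add, ha P φ hφ, hb P φ hφ]
  smul_mem' r _ ha P φ hφ := by rw [map_smul, map_smul, ha P φ hφ]

/-- The stable elements `M(S)^F` for a category `F` on the closed subgroups of a pro-`p` group `S`:
those `x` for which `i_P^* x = φ^* x` for all closed subgroups `P` with inclusion `i_P` and all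
`φ ∈ Hom_F(P, S)`. -/
def stable {S : Type u} [Group S] [TopologicalSpace S] [IsProPGroup p S]
    (F : ClosedSubgroupCategory S) : Submodule R (M.ext S) where
  carrier := {x | ∀ (P : ClosedSubgroup S) (φ : P →ₜ* (⊤ : ClosedSubgroup S)), φ ∈ F.Hom P ⊤ →
    M.extPull P.incl x = M.extPull ((⊤ : ClosedSubgroup S).incl.comp φ) x}
  zero_mem' _ _ _ := by simp
  add_mem' ha hb P φ hφ := by rw [map_add, map_add, ha P φ hφ, hb P φ hφ]
  smul_mem' r _ ha P φ hφ := by rw [map_smul, map_smul, ha P φ hφ]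

/-- A morphism `α` of fusion systems sends stable elements to stable elements under `α^*`. -/
theorem pull_mem_finStable {S T : Type u} [Group S] [Group T] [IsFinPGroup p S] [IsFinPGroup p T]
    {F : FusionSystem S} {G : FusionSystem T} {α : S →* T} (hα : F.IsMorphism G α)
    {x : M.val T} (hx : x ∈ M.finStable G) : M.pull α x ∈ M.finStable F := by
  intro P φ hφ
  obtain ⟨ψ, hψ, hψα⟩ := hα P ⊤ φ hφ
  have key := hx (P.map α) ((Subgroup.inclusion le_top).comp ψ)
    (G.comp_mem (G.inclusion_mem le_top) hψ)
  have e1 : α.comp P.subtype = (P.map α).subtype.comp (α.subgroupMap P) := rfl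
  have e2 : α.comp ((⊤ : Subgroup S).subtype.comp φ) =
      ((⊤ : Subgroup T).subtype.comp ((Subgroup.inclusion le_top).comp ψ)).comp
        (α.subgroupMap P) := by
    ext y
    exact (hψα y).symm
  rw [← M.pull_comp, ← M.pull_comp, e1, e2, M.pull_comp, key, ← M.pull_comp]

variable {I : Type t} [Preorder I] (𝓕 : FusionInverseSystem.{u} p I)

/-- The transition maps `M(S i)^{F i} → M(S j)^{F j}` for `i ≤ j`, given by inflation. -/
def stableTransition (i j : I) (hij : i ≤ j) :
    M.finStable (𝓕.F i) →ₗ[R] M.finStable (𝓕.F j) :=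
  (M.pull (𝓕.f hij)).restrict (fun _ hx => M.pull_mem_finStable (𝓕.isMorphism hij) hx)

open Classical in
/-- The direct limit of the modules `M(S i)^{F i}`. -/
abbrev StableLimit : Type (max t w) :=
  Module.DirectLimit (R := R) (fun i => M.finStable (𝓕.F i)) (M.stableTransition 𝓕)

open Classical in
/-- The canonical map from `M(S i)^{F i}` to the direct limit. -/
def toStableLimit (i : I) : M.finStable (𝓕.F i) →ₗ[R] M.StableLimit 𝓕 :=
  Module.DirectLimit.of R I (fun i => M.finStable (𝓕.F i)) (M.stableTransition 𝓕) i

end PGroupFunctor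

end

/-!
The pro-`p` group `S` is a limit of finite groups, so compactness gives `M(S) = colim M(S i)`: the
kernels of the projections `π i` are a neighbourhood basis of the identity
(`exists_ker_subset`), and although the transition maps need not be onto, the image of `S j` in
`S i` equals that of `S` once `j` is large (`exists_range_le`). Hence every element of `M(S)` is
inflated from some `S i` (`exists_inflation_eq`), and an element of `M(S i)` which inflates to zero
already vanishes in some `M(S j)` (`exists_pull_eq_zero`). The latter is the injectivity.

For surjectivity it has to be shown that if `x ∈ M(S i)` has stable inflation then the image of `x`
in some `M(S j)` is stable (`exists_pull_mem_finStable`). Suppose not. At each stage `j ≥ i` the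
morphisms `φ : P → S j` of `F j` with `φ^* x ≠ i_P^* x` form a non-empty finite set, and the
transition functors preserve this set, since pulling back an equality gives an equality. By König's
lemma there is a compatible family of such morphisms `φ_j : P_j → S j`. Its limit is a morphism
`φ : P → S` of `F` with `P_j` the image of `P` (`exists_hom_of_isGraph`). As the inflation of `x` is
stable, `φ^*` and `i_P^*` agree on it in `M(P) = colim M(P_j)`, hence they agree on `x` in some
`M(P_j)`: a contradiction.

Morphisms `P → S j` are encoded by their graphs, the subgroups `Γ` of `S j × S j`. In this form the
transition maps are direct images, `P_j` is replaced by `Γ_j`, and the equality to be tested is that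
of the maps induced by the two projections from `Γ`.
-/

/-! ### Inverse systems of finite sets -/

section FiniteSets

variable {I : Type t} [Preorder I] [IsDirectedOrder I] {X : I → Type u} [∀ i, Finite (X i)]

/-- An inverse system of non-empty finite sets has a compatible family of elements. -/
theorem exists_compatible_of_finite [∀ i, Nonempty (X i)] (f : ∀ {i j : I}, i ≤ j → X j → X i)
    (f_refl : ∀ (i : I) (x : X i), f (le_refl i) x = x)
    (f_trans : ∀ {i j k : I} (hij : i ≤ j) (hjk : j ≤ k) (x : X k),
      f hij (f hjk x) = f (hij.trans hjk) x) :
    ∃ s : ∀ i, X i, ∀ {i j : I} (hij : i ≤ j), f hij (s j) = s i := by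
  let D : Iᵒᵖ ⥤ Type u :=
    { obj := fun i => X i.unop
      map := fun g => ↾(f (leOfHom g.unop))
      map_id := fun i => by ext x; exact f_refl _ x
      map_comp := fun g h => by ext x; exact (f_trans _ _ x).symm }
  have : ∀ j : Iᵒᵖ, Finite (D.obj j) := fun j => inferInstanceAs (Finite (X j.unop))
  have : ∀ j : Iᵒᵖ, Nonempty (D.obj j) := fun j => inferInstanceAs (Nonempty (X j.unop))
  obtain ⟨s, hs⟩ := nonempty_sections_of_finite_inverse_system D
  exact ⟨fun i => s (Opposite.op i), fun hij => hs (homOfLE hij).op⟩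

/-- In an inverse system of finite sets, an element which lies in the image of every transition
map extends to a compatible family. -/
theorem exists_compatible_eq_of_finite (f : ∀ {i j : I}, i ≤ j → X j → X i)
    (f_refl : ∀ (i : I) (x : X i), f (le_refl i) x = x)
    (f_trans : ∀ {i j k : I} (hij : i ≤ j) (hjk : j ≤ k) (x : X k),
      f hij (f hjk x) = f (hij.trans hjk) x)
    (i : I) (y : X i) (hy : ∀ (j : I) (hij : i ≤ j), ∃ x, f hij x = y) :
    ∃ s : ∀ i, X i, (∀ {i j : I} (hij : i ≤ j), f hij (s j) = s i) ∧ s i = y := by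
  -- At an index `j` not above `i` no condition is imposed, so that the fibres over `y` form an
  -- inverse system over the whole of `I`.
  let Y : I → Type u := fun j => {x : X j // ∀ hij : i ≤ j, f hij x = y}
  have : ∀ j, Finite (Y j) := fun j => Subtype.finite
  have : ∀ j, Nonempty (Y j) := fun j => by
    obtain ⟨k, hik, hjk⟩ := exists_ge_ge i j
    obtain ⟨x, hx⟩ := hy k hik
    exact ⟨⟨f hjk x, fun hij => by rw [f_trans, hx]⟩⟩
  obtain ⟨s, hs⟩ := exists_compatible_of_finite (X := Y)
    (fun {j k} hjk x => ⟨f hjk x.1, fun hij => by rw [f_trans]; exact x.2 _⟩)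
    (fun j x => Subtype.ext (f_refl j x.1)) (fun hij hjk x => Subtype.ext (f_trans hij hjk x.1))
  exact ⟨fun j => (s j).1, fun hjk => congrArg Subtype.val (hs hjk),
    (f_refl i _).symm.trans ((s i).2 le_rfl)⟩

end FiniteSets

/-! ### The functor on pro-`p` groups -/

theorem MonoidHom.isOpen_ker_comp {G A B : Type*} [Group G] [TopologicalSpace G]
    [IsTopologicalGroup G] [Group A] [Group B] (h : A →* B) (π : G →* A)
    (hπ : IsOpen (π.ker : Set G)) : IsOpen ((h.comp π).ker : Set G) :=
  Subgroup.isOpen_mono (H₁ := π.ker) (fun x (hx : π x = 1) => by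
    rw [MonoidHom.mem_ker, MonoidHom.comp_apply, hx, map_one]) hπ

namespace PGroupFunctor

variable {p : ℕ} {R : Type v} [Ring R] (M : PGroupFunctor.{u, v, w} p R)

section Inflation

variable {G : Type u} [Group G] [TopologicalSpace G] [IsProPGroup p G]

instance directedSystem_quotientTransition :
    DirectedSystem (fun N : (OpenNormalSubgroup G)ᵒᵈ =>
      M.val (G ⧸ (OrderDual.ofDual N).toSubgroup)) (M.quotientTransition G · · ·) where
  map_self N x := by
    have e : quotientProj (le_refl (OrderDual.ofDual N)) = MonoidHom.id _ := by
      ext y; rfl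
    change M.pull (quotientProj (le_refl (OrderDual.ofDual N))) x = x
    rw [e, M.pull_id]
  map_map L K N hNK hKL x := by
    change M.pull (quotientProj _) (M.pull (quotientProj _) x) = M.pull (quotientProj _) x
    rw [← M.pull_comp]
    congr 2
    ext y; rfl

theorem exists_toExt (x : M.ext G) :
    ∃ (N : OpenNormalSubgroup G) (z : M.val (G ⧸ N.toSubgroup)), M.toExt N z = x := by
  classical
  have : Nonempty (OpenNormalSubgroup G)ᵒᵈ :=
    ⟨OrderDual.toDual (kerOpenNormal (1 : G →* G) (by simp))⟩
  obtain ⟨N, z, hz⟩ := Module.DirectLimit.exists_of (f := M.quotientTransition G) x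
  exact ⟨OrderDual.ofDual N, z, hz⟩

theorem exists_of_toExt_eq {N : OpenNormalSubgroup G} {x y : M.val (G ⧸ N.toSubgroup)}
    (h : M.toExt N x = M.toExt N y) : ∃ (K : OpenNormalSubgroup G) (hK : K ≤ N),
      M.pull (quotientProj hK) x = M.pull (quotientProj hK) y := by
  classical
  obtain ⟨K, hK, e⟩ := Module.DirectLimit.exists_eq_of_of_eq (f := M.quotientTransition G)
    (i := OrderDual.toDual N) h
  exact ⟨OrderDual.ofDual K, hK, e⟩

variable {A B : Type u} [Group A] [Group B] [IsFinPGroup p A] [IsFinPGroup p B]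

/-- Inflation may be computed through any open normal subgroup contained in the kernel. -/
theorem toExt_pull_eq_inflation (π : G →* A) (hπ : IsOpen (π.ker : Set G))
    (N : OpenNormalSubgroup G) (q : G ⧸ N.toSubgroup →* A)
    (hq : q.comp (QuotientGroup.mk' N.toSubgroup) = π) (a : M.val A) :
    M.toExt N (M.pull q a) = M.inflation π hπ a := by
  have hN : N ≤ kerOpenNormal π hπ := fun x hx => by
    change π x = 1
    rw [← hq, MonoidHom.comp_apply, QuotientGroup.mk'_apply,
      (QuotientGroup.eq_one_iff x).mpr hx, map_one]
  have e : q = (kerQuotientMap π hπ).comp (quotientProj hN) := by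
    ext y
    exact DFunLike.congr_fun hq y
  rw [e, M.pull_comp, M.toExt_transition]
  rfl

theorem inflation_pull (h : A →* B) (π : G →* A) (hπ : IsOpen (π.ker : Set G))
    (hhπ : IsOpen ((h.comp π).ker : Set G)) (b : M.val B) :
    M.inflation π hπ (M.pull h b) = M.inflation (h.comp π) hhπ b := by
  change M.toExt _ (M.pull _ (M.pull h b)) = _
  rw [← M.pull_comp]
  refine M.toExt_pull_eq_inflation _ hhπ _ _ ?_ b
  ext y; rfl

theorem inflation_mk' (N : OpenNormalSubgroup G)
    (hN : IsOpen ((QuotientGroup.mk' N.toSubgroup).ker : Set G)) (z : M.val (G ⧸ N.toSubgroup)) :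
    M.inflation (QuotientGroup.mk' N.toSubgroup) hN z = M.toExt N z := by
  rw [← M.toExt_pull_eq_inflation _ hN N (MonoidHom.id _) rfl, M.pull_id]

/-- Equality of two inflated elements is already visible in every sufficiently large finite
quotient `C` of `G`. -/
theorem exists_of_inflation_eq {α : G →* A} {β : G →* B} (hα : IsOpen (α.ker : Set G))
    (hβ : IsOpen (β.ker : Set G)) {a : M.val A} {b : M.val B}
    (h : M.inflation α hα a = M.inflation β hβ b) :
    ∃ N : OpenNormalSubgroup G, ∀ {C : Type u} [Group C] [IsFinPGroup p C] (γ : G →* C)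
      (α' : C →* A) (β' : C →* B), Function.Surjective γ → γ.ker ≤ N.toSubgroup →
      α'.comp γ = α → β'.comp γ = β → M.pull α' a = M.pull β' b := by
  let L : OpenNormalSubgroup G := kerOpenNormal α hα ⊓ kerOpenNormal β hβ
  have hLα : L ≤ kerOpenNormal α hα := inf_le_left
  have hLβ : L ≤ kerOpenNormal β hβ := inf_le_right
  have hα' := M.toExt_pull_eq_inflation α hα L
    ((kerQuotientMap α hα).comp (quotientProj hLα)) (by ext y; rfl) a
  have hβ' := M.toExt_pull_eq_inflation β hβ L
    ((kerQuotientMap β hβ).comp (quotientProj hLβ)) (by ext y; rfl) b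
  obtain ⟨N, hN, e⟩ := M.exists_of_toExt_eq (hα'.trans (h.trans hβ'.symm))
  refine ⟨N, fun {C} _ _ γ α' β' hγ hker hα'' hβ'' => ?_⟩
  let q : C →* G ⧸ N.toSubgroup :=
    γ.liftOfSurjective hγ ⟨QuotientGroup.mk' _, by simpa using hker⟩
  have hq : ∀ x, q (γ x) = QuotientGroup.mk' N.toSubgroup x := fun x =>
    γ.liftOfRightInverse_comp_apply _ _ ⟨QuotientGroup.mk' _, by simpa using hker⟩ x
  have e1 : α' =
      (((kerQuotientMap α hα).comp (quotientProj hLα)).comp (quotientProj hN)).comp q := by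
    ext c
    obtain ⟨x, rfl⟩ := hγ c
    rw [MonoidHom.comp_apply, hq]
    exact DFunLike.congr_fun hα'' x
  have e2 : β' =
      (((kerQuotientMap β hβ).comp (quotientProj hLβ)).comp (quotientProj hN)).comp q := by
    ext c
    obtain ⟨x, rfl⟩ := hγ c
    rw [MonoidHom.comp_apply, hq]
    exact DFunLike.congr_fun hβ'' x
  rw [e1, e2]
  simp only [M.pull_comp] at e ⊢
  rw [e]

variable {H : Type u} [Group H] [TopologicalSpace H] [IsProPGroup p H]

theorem extPull_inflation (φ : G →ₜ* H) (π : H →* A) (hπ : IsOpen (π.ker : Set H))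
    (hφ : IsOpen ((π.comp φ.toMonoidHom).ker : Set G)) (a : M.val A) :
    M.extPull φ (M.inflation π hπ a) = M.inflation (π.comp φ.toMonoidHom) hφ a := by
  change M.extPull φ (M.toExt _ (M.pull _ a)) = _
  rw [M.extPull_toExt, ← M.pull_comp]
  refine M.toExt_pull_eq_inflation _ hφ _ _ ?_ a
  ext y; rfl

end Inflation

end PGroupFunctor

/-! ### Morphisms of fusion systems and their graphs -/

instance IsFinPGroup.prod {p : ℕ} {A B : Type u} [Group A] [Group B] [hA : IsFinPGroup p A]
    [hB : IsFinPGroup p B] : IsFinPGroup p (A × B) where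
  finite := by
    have := hA.finite
    have := hB.finite
    infer_instance
  isPGroup x := by
    obtain ⟨m, hm⟩ := hA.isPGroup x.1
    obtain ⟨n, hn⟩ := hB.isPGroup x.2
    refine ⟨m + n, Prod.ext ?_ ?_⟩
    · rw [Prod.pow_fst, pow_add, pow_mul, hm, one_pow, Prod.fst_one]
    · rw [Prod.pow_snd, pow_add, mul_comm, pow_mul, hn, one_pow, Prod.snd_one]

namespace FusionSystem

variable {S : Type u} [Group S] (F : FusionSystem S)

/-- A morphism of a fusion system stays one when its codomain is changed. -/
theorem mem_hom_of_coe_eq {P Q T : Subgroup S} {φ : P →* Q} (hφ : φ ∈ F.Hom P Q) (ψ : P →* T)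
    (h : ∀ x, (ψ x : S) = φ x) : ψ ∈ F.Hom P T := by
  have hinj : Function.Injective (Q.subtype.comp φ) :=
    Q.subtype_injective.comp (F.injective hφ)
  have hle : (Q.subtype.comp φ).range ≤ T := by
    rintro _ ⟨x, rfl⟩
    change (φ x : S) ∈ T
    rw [← h]
    exact (ψ x).2
  have e : ψ = (Subgroup.inclusion hle).comp (MonoidHom.ofInjective hinj).toMonoidHom := by
    ext x
    exact h x
  rw [e]
  exact F.comp_mem (F.inclusion_mem hle) (F.iso_mem hφ (MonoidHom.ofInjective hinj)
    fun x => rfl).1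

/-- `Γ` is the graph of a morphism `P → S` of the fusion system, as a subgroup of `S × S`. -/
def IsGraph (Γ : Subgroup (S × S)) : Prop :=
  ∃ (P : Subgroup S) (φ : P →* (⊤ : Subgroup S)), φ ∈ F.Hom P ⊤ ∧
    ∀ a b : S, (a, b) ∈ Γ ↔ ∃ h : a ∈ P, (φ ⟨a, h⟩ : S) = b

variable {F} in
theorem IsMorphism.isGraph_map {T : Type t} [Group T] {G : FusionSystem T} {α : S →* T}
    (hα : F.IsMorphism G α) {Γ : Subgroup (S × S)} (hΓ : F.IsGraph Γ) :
    G.IsGraph (Γ.map (α.prodMap α)) := by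
  obtain ⟨P, φ, hφ, h⟩ := hΓ
  obtain ⟨ψ, hψ, hψα⟩ := hα P ⊤ φ hφ
  refine ⟨P.map α, (Subgroup.inclusion le_top).comp ψ,
    G.comp_mem (G.inclusion_mem le_top) hψ, fun a b => ⟨?_, ?_⟩⟩
  · rintro ⟨⟨c, d⟩, hcd, he⟩
    obtain ⟨rfl, rfl⟩ := Prod.ext_iff.mp he
    obtain ⟨hc, rfl⟩ := (h c d).mp hcd
    exact ⟨Subgroup.mem_map_of_mem α hc, hψα ⟨c, hc⟩⟩
  · rintro ⟨⟨c, hc, rfl⟩, rfl⟩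
    exact ⟨(c, φ ⟨c, hc⟩), (h _ _).mpr ⟨hc, rfl⟩, Prod.ext rfl (hψα ⟨c, hc⟩).symm⟩

end FusionSystem

namespace PGroupFunctor

variable {p : ℕ} {R : Type v} [Ring R] (M : PGroupFunctor.{u, v, w} p R)

/-- The two projections of `Γ ≤ S × S` to `S` induce the same map on `x`. -/
def EqualizedOn {S : Type u} [Group S] [IsFinPGroup p S] (x : M.val S)
    (Γ : Subgroup (S × S)) : Prop :=
  M.pull ((MonoidHom.fst S S).comp Γ.subtype) x = M.pull ((MonoidHom.snd S S).comp Γ.subtype) x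

variable {M} in
theorem EqualizedOn.of_map {S T : Type u} [Group S] [Group T] [IsFinPGroup p S] [IsFinPGroup p T]
    {α : S →* T} {x : M.val T} {Γ : Subgroup (S × S)}
    (h : M.EqualizedOn x (Γ.map (α.prodMap α))) : M.EqualizedOn (M.pull α x) Γ := by
  have h' := congrArg (M.pull ((α.prodMap α).subgroupMap Γ)) h
  simp only [← M.pull_comp] at h'
  rw [EqualizedOn, ← M.pull_comp, ← M.pull_comp]
  exact h'

theorem mem_finStable_of_equalizedOn {S : Type u} [Group S] [IsFinPGroup p S]
    {F : FusionSystem S} {x : M.val S} (h : ∀ Γ, F.IsGraph Γ → M.EqualizedOn x Γ) :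
    x ∈ M.finStable F := by
  intro P φ hφ
  let g : P →* S × S := P.subtype.prod ((⊤ : Subgroup S).subtype.comp φ)
  have hg : F.IsGraph g.range := by
    refine ⟨P, φ, hφ, fun a b => ⟨?_, ?_⟩⟩
    · rintro ⟨y, hy⟩
      obtain ⟨rfl, rfl⟩ := Prod.ext_iff.mp hy
      exact ⟨y.2, rfl⟩
    · rintro ⟨ha, rfl⟩
      exact ⟨⟨a, ha⟩, rfl⟩
  have h' := congrArg (M.pull g.rangeRestrict) (h _ hg)
  simp only [← M.pull_comp] at h'
  exact h'

end PGroupFunctor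

/-! ### Inverse limits of fusion systems -/

namespace ClosedSubgroupCategory.IsInverseLimit

variable {p : ℕ} {S : Type u} [Group S] [TopologicalSpace S] {I : Type t} [Preorder I]
  {𝓕 : FusionInverseSystem.{r, t} p I} {π : ∀ i, S →* 𝓕.S i} {F : ClosedSubgroupCategory S}
  (hF : F.IsInverseLimit 𝓕 π)

include hF

theorem ker_le {i j : I} (hij : i ≤ j) : (π j).ker ≤ (π i).ker := fun x (hx : π j x = 1) => by
  rw [MonoidHom.mem_ker, ← hF.compatible hij, hx, map_one]

theorem eq_of_forall {x y : S} (h : ∀ i, π i x = π i y) : x = y :=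
  (hF.existsUnique (fun i => π i y) (fun hij => hF.compatible hij y)).unique h fun _ => rfl

variable [IsDirectedOrder I]

/-- By compactness, the kernels of the projections form a neighbourhood basis of the identity. -/
theorem exists_ker_subset [IsTopologicalGroup S] [CompactSpace S] (i : I) {U : Set S}
    (hU : U ∈ nhds 1) : ∃ k, i ≤ k ∧ ((π k).ker : Set S) ⊆ U := by
  have : Nonempty I := ⟨i⟩
  obtain ⟨j, hj⟩ := exists_subset_nhds_of_compactSpace (V := fun k => ((π k).ker : Set S))
    (fun a b => by
      obtain ⟨c, hac, hbc⟩ := exists_ge_ge a b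
      exact ⟨c, hF.ker_le hac, hF.ker_le hbc⟩)
    (fun k => Subgroup.isClosed_of_isOpen _ (hF.isOpen_ker k)) (U := U) (fun x hx => by
      have hx1 : x = 1 := hF.eq_of_forall fun k => by
        rw [map_one]
        exact Set.mem_iInter.mp hx k
      rwa [hx1])
  obtain ⟨k, hik, hjk⟩ := exists_ge_ge i j
  exact ⟨k, hik, fun x hx => hj (hF.ker_le hjk hx)⟩

/-- The transition maps need not be onto, but far enough up in the system their images are those
of the limit. -/
theorem exists_range_le (i : I) : ∃ (j : I) (hij : i ≤ j), (𝓕.f hij).range ≤ (π i).range := by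
  have : Nonempty I := ⟨i⟩
  have hfin : ∀ j, Finite (𝓕.S j) := fun j => (𝓕.isFinPGroup j).finite
  have key : ∀ y : 𝓕.S i, ∃ j, i ≤ j ∧ ∀ (k : I) (hik : i ≤ k), j ≤ k →
      y ∈ (𝓕.f hik).range → y ∈ (π i).range := by
    intro y
    by_cases hy : ∀ (j : I) (hij : i ≤ j), ∃ x, 𝓕.f hij x = y
    · obtain ⟨s, hs, hsy⟩ := exists_compatible_eq_of_finite (fun hij => 𝓕.f hij) 𝓕.f_refl
        𝓕.f_trans i y hy
      obtain ⟨x, hx, -⟩ := hF.existsUnique s hs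
      exact ⟨i, le_rfl, fun _ _ _ _ => ⟨x, (hx i).trans hsy⟩⟩
    · push Not at hy
      obtain ⟨j, hij, hj⟩ := hy
      refine ⟨j, hij, fun k hik hjk => ?_⟩
      rintro ⟨x, hx⟩
      exact absurd ((𝓕.f_trans hij hjk x).trans hx) (hj _)
  choose b hib hb using key
  obtain ⟨j, hj⟩ := (Set.finite_range b).bddAbove
  obtain ⟨k, hik, hjk⟩ := exists_ge_ge i j
  exact ⟨k, hik, fun y hy => hb y k hik ((hj ⟨y, rfl⟩).trans hjk) hy⟩

/-- A compatible family of graphs of morphisms of the `𝓕.F j` comes from a morphism `φ : P → S` of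
the inverse limit, and each graph is the image of that of `φ`. -/
theorem exists_hom_of_isGraph [Nonempty I] [IsTopologicalGroup S] [CompactSpace S]
    (Γ : ∀ j, Subgroup (𝓕.S j × 𝓕.S j)) (hΓ : ∀ j, (𝓕.F j).IsGraph (Γ j))
    (hmap : ∀ {j k : I} (hjk : j ≤ k), (Γ k).map ((𝓕.f hjk).prodMap (𝓕.f hjk)) = Γ j) :
    ∃ (P : ClosedSubgroup S) (φ : P →ₜ* (⊤ : ClosedSubgroup S)), φ ∈ F.Hom P ⊤ ∧
      (∀ j (x : P), (π j x, π j (φ x)) ∈ Γ j) ∧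
      ∀ j, ∀ z ∈ Γ j, ∃ x : P, (π j x, π j (φ x)) = z := by
  choose P φ hφ hP using hΓ
  have hfun : ∀ {j a b c}, (a, b) ∈ Γ j → (a, c) ∈ Γ j → b = c := by
    intro j a b c hb hc
    obtain ⟨h, rfl⟩ := (hP j _ _).mp hb
    exact ((hP j _ _).mp hc).2
  let P' : ClosedSubgroup S :=
    { toSubgroup := ⨅ j, (P j).comap (π j)
      isClosed' := by
        change IsClosed ((⨅ j, (P j).comap (π j) : Subgroup S) : Set S)
        rw [Subgroup.coe_iInf]
        exact isClosed_iInter fun j => Subgroup.isClosed_of_isOpen _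
          (Subgroup.isOpen_mono ((π j).ker_le_comap (P j)) (hF.isOpen_ker j)) }
  have hP' : ∀ {x : S}, x ∈ P' ↔ ∀ j, π j x ∈ P j := fun {x} => Subgroup.mem_iInf
  have hex : ∀ x : P', ∃ y : S, ∀ j, (π j x, π j y) ∈ Γ j := by
    intro x
    have hx : ∀ j, (π j x, ((φ j ⟨π j x, hP'.mp x.2 j⟩ : (⊤ : Subgroup (𝓕.S j))) : 𝓕.S j)) ∈ Γ j :=
      fun j => (hP j _ _).mpr ⟨hP'.mp x.2 j, rfl⟩
    obtain ⟨y, hy, -⟩ := hF.existsUnique (fun j => (φ j ⟨π j x, hP'.mp x.2 j⟩).1) (by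
      intro j k hjk
      refine hfun ?_ (hx j)
      have := Subgroup.mem_map_of_mem ((𝓕.f hjk).prodMap (𝓕.f hjk)) (hx k)
      rw [hmap hjk] at this
      rw [← hF.compatible hjk]
      exact this)
    exact ⟨y, fun j => by rw [hy]; exact hx j⟩
  choose g hg using hex
  let ψ : P' →* S :=
    { toFun := g
      map_one' := hF.eq_of_forall fun j => hfun (hg 1 j) (by
        rw [map_one]
        exact (congrArg (fun z => (z, (1 : 𝓕.S j)) ∈ Γ j) (map_one (π j))).mpr (one_mem (Γ j)))
      map_mul' := fun x y => hF.eq_of_forall fun j => hfun (hg (x * y) j) (by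
        rw [map_mul]
        exact (congrArg (fun z => (z, π j (g x) * π j (g y)) ∈ Γ j)
          (map_mul (π j) (x : S) y)).mpr (mul_mem (hg x j) (hg y j))) }
  have hψ : Continuous ψ := by
    have : IsTopologicalGroup P' := inferInstanceAs (IsTopologicalGroup P'.toSubgroup)
    refine continuous_of_continuousAt_one ψ ?_
    rw [ContinuousAt, map_one]
    intro U hU
    obtain ⟨k, -, hk⟩ := hF.exists_ker_subset (Classical.arbitrary I) hU
    have hopen : {x : P' | (x : S) ∈ (π k).ker} ∈ nhds (1 : P') :=
      ((hF.isOpen_ker k).preimage continuous_subtype_val).mem_nhds (one_mem (π k).ker)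
    refine Filter.mem_map.mpr (Filter.mem_of_superset hopen fun x hx => hk ?_)
    have hx1 : π k x = 1 := hx
    have := hg x k
    rw [hx1] at this
    exact hfun this (one_mem (Γ k))
  let φ' : P' →ₜ* (⊤ : ClosedSubgroup S) :=
    { toMonoidHom := ψ.codRestrict (⊤ : Subgroup S) fun _ => trivial
      continuous_toFun := hψ.subtype_mk _ }
  have hφ' : ∀ j (x : P'), (π j x, π j (φ' x)) ∈ Γ j := fun j x => hg x j
  refine ⟨P', φ', (hF.mem_hom_iff _ _ _).mpr fun j => ?_, hφ', fun j z hz => ?_⟩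
  · have hle : P'.toSubgroup.map (π j) ≤ P j := by
      rintro _ ⟨x, hx, rfl⟩
      exact hP'.mp hx j
    have hval : ∀ x : P', (φ j ⟨π j x, hP'.mp x.2 j⟩ : 𝓕.S j) = π j (φ' x) := fun x =>
      ((hP j _ _).mp (hφ' j x)).2
    have hφle := (𝓕.F j).comp_mem (hφ j) ((𝓕.F j).inclusion_mem hle)
    refine ⟨(((⊤ : Subgroup (𝓕.S j)).subtype.comp (φ j)).comp
      (Subgroup.inclusion hle)).codRestrict _ ?_, (𝓕.F j).mem_hom_of_coe_eq hφle _ fun _ => rfl,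
      hval⟩
    rintro ⟨_, x, hx, rfl⟩
    exact ⟨φ' ⟨x, hx⟩, trivial, (hval ⟨x, hx⟩).symm⟩
  · have hfin : ∀ k, Finite (Γ k) := fun k => by
      have := (𝓕.isFinPGroup k).finite
      infer_instance
    obtain ⟨s, hs, hsz⟩ := exists_compatible_eq_of_finite (X := fun k => Γ k)
      (fun {k l} hkl y => ⟨(𝓕.f hkl).prodMap (𝓕.f hkl) y.1, by
        rw [← hmap hkl]
        exact Subgroup.mem_map_of_mem _ y.2⟩)
      (fun k y => Subtype.ext (Prod.ext (𝓕.f_refl _ _) (𝓕.f_refl _ _)))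
      (fun hij hjk y => Subtype.ext (Prod.ext (𝓕.f_trans hij hjk _) (𝓕.f_trans hij hjk _)))
      j ⟨z, hz⟩ (fun k hjk => by
        obtain ⟨y, hy, hyz⟩ : z ∈ (Γ k).map ((𝓕.f hjk).prodMap (𝓕.f hjk)) := by rwa [hmap hjk]
        exact ⟨⟨y, hy⟩, Subtype.ext hyz⟩)
    obtain ⟨x, hx, -⟩ := hF.existsUnique (fun k => (s k).1.1)
      (fun hij => congrArg (fun y => y.1.1) (hs hij))
    have hxP : x ∈ P' := hP'.mpr fun k => by
      rw [hx]
      exact ((hP k _ _).mp (s k).2).1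
    refine ⟨⟨x, hxP⟩, ?_⟩
    have h1 : π j x = z.1 := (hx j).trans (congrArg (fun y => y.1.1) hsz)
    have h2 := hφ' j ⟨x, hxP⟩
    refine Prod.ext h1 (hfun h2 ?_)
    change (π j x, z.2) ∈ Γ j
    rwa [h1]

end ClosedSubgroupCategory.IsInverseLimit

/-! ### Stable elements of an inverse limit -/

namespace ClosedSubgroupCategory.IsInverseLimit

variable {p : ℕ} {R : Type v} [Ring R] (M : PGroupFunctor.{u, v, w} p R)
  {S : Type u} [Group S] [TopologicalSpace S] [IsProPGroup p S] {I : Type t} [Preorder I]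
  {𝓕 : FusionInverseSystem.{u, t} p I} {π : ∀ i, S →* 𝓕.S i} {F : ClosedSubgroupCategory S}
  (hF : F.IsInverseLimit 𝓕 π)

include hF

theorem inflation_pull_transition {i j : I} (hij : i ≤ j) (x : M.val (𝓕.S i)) :
    M.inflation (π j) (hF.isOpen_ker j) (M.pull (𝓕.f hij) x) =
      M.inflation (π i) (hF.isOpen_ker i) x := by
  have e : (𝓕.f hij).comp (π j) = π i := by
    ext y
    exact hF.compatible hij y
  rw [M.inflation_pull _ _ _ (MonoidHom.isOpen_ker_comp _ _ (hF.isOpen_ker j))]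
  congr 2

theorem inflation_mem_stable (i : I) {x : M.val (𝓕.S i)} (hx : x ∈ M.finStable (𝓕.F i)) :
    M.inflation (π i) (hF.isOpen_ker i) x ∈ M.stable F := by
  intro P φ hφ
  obtain ⟨ψ, hψ, hψφ⟩ := (hF.mem_hom_iff P ⊤ φ).mp hφ i
  let γ : P →* P.toSubgroup.map (π i) := (π i).subgroupMap P.toSubgroup
  have hγ : IsOpen (γ.ker : Set P) := by
    have e : (γ.ker : Set P) = (fun y : P => (y : S)) ⁻¹' ((π i).ker : Set S) := by
      ext y
      exact Subtype.ext_iff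
    rw [e]
    exact (hF.isOpen_ker i).preimage continuous_subtype_val
  have key := congrArg (M.inflation γ hγ) (hx _ ((Subgroup.inclusion le_top).comp ψ)
    ((𝓕.F i).comp_mem ((𝓕.F i).inclusion_mem le_top) hψ))
  rw [M.inflation_pull _ _ _ (MonoidHom.isOpen_ker_comp _ _ hγ),
    M.inflation_pull _ _ _ (MonoidHom.isOpen_ker_comp _ _ hγ)] at key
  have e1 : (P.toSubgroup.map (π i)).subtype.comp γ = (π i).comp P.incl.toMonoidHom := rfl
  have e2 : ((⊤ : Subgroup (𝓕.S i)).subtype.comp ((Subgroup.inclusion le_top).comp ψ)).comp γ =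
      (π i).comp ((⊤ : ClosedSubgroup S).incl.comp φ).toMonoidHom := by
    ext y
    exact hψφ y
  simp only [e1, e2] at key
  rwa [M.extPull_inflation _ _ _ (by rw [← e1]; exact MonoidHom.isOpen_ker_comp _ _ hγ),
    M.extPull_inflation _ _ _ (by rw [← e2]; exact MonoidHom.isOpen_ker_comp _ _ hγ)]

variable [IsDirectedOrder I]

theorem exists_inflation_eq [Nonempty I] (x : M.ext S) :
    ∃ (i : I) (y : M.val (𝓕.S i)), M.inflation (π i) (hF.isOpen_ker i) y = x := by
  obtain ⟨N, z, rfl⟩ := M.exists_toExt x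
  obtain ⟨k, -, hk⟩ := hF.exists_ker_subset (Classical.arbitrary I)
    (N.isOpen'.mem_nhds (one_mem N))
  obtain ⟨j, hkj, hj⟩ := hF.exists_range_le k
  -- `S j` maps to the image of `π k`, which is `S ⧸ ker (π k)` and so maps onto `S ⧸ N`.
  have hker : (π k).rangeRestrict.ker ≤ (QuotientGroup.mk' N.toSubgroup).ker := by
    rw [MonoidHom.ker_rangeRestrict, QuotientGroup.ker_mk']
    exact hk
  let q : (π k).range →* S ⧸ N.toSubgroup :=
    (π k).rangeRestrict.liftOfSurjective (π k).rangeRestrict_surjective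
      ⟨QuotientGroup.mk' N.toSubgroup, hker⟩
  let h : 𝓕.S j →* (π k).range := (𝓕.f hkj).codRestrict _ fun y => hj ⟨y, rfl⟩
  have e : (q.comp h).comp (π j) = QuotientGroup.mk' N.toSubgroup := by
    ext y
    have hy : h (π j y) = (π k).rangeRestrict y := Subtype.ext (hF.compatible hkj y)
    rw [MonoidHom.comp_apply, MonoidHom.comp_apply, hy]
    exact (π k).rangeRestrict.liftOfRightInverse_comp_apply _ _
      ⟨QuotientGroup.mk' N.toSubgroup, hker⟩ y
  refine ⟨j, M.pull (q.comp h) z, ?_⟩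
  rw [M.inflation_pull _ _ _ (MonoidHom.isOpen_ker_comp _ _ (hF.isOpen_ker j))]
  simp only [e]
  exact M.inflation_mk' N _ z

theorem exists_pull_eq_zero {i : I} {x : M.val (𝓕.S i)}
    (hx : M.inflation (π i) (hF.isOpen_ker i) x = 0) :
    ∃ (j : I) (hij : i ≤ j), M.pull (𝓕.f hij) x = 0 := by
  rw [← map_zero (M.inflation (π i) (hF.isOpen_ker i))] at hx
  obtain ⟨N, hN⟩ := M.exists_of_inflation_eq _ _ hx
  obtain ⟨k, hik, hk⟩ := hF.exists_ker_subset i (N.isOpen'.mem_nhds (one_mem N))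
  obtain ⟨j, hkj, hj⟩ := hF.exists_range_le k
  have e : ((𝓕.f hik).comp (π k).range.subtype).comp (π k).rangeRestrict = π i := by
    ext y
    exact hF.compatible hik y
  have key := hN (π k).rangeRestrict _ _ (π k).rangeRestrict_surjective
    (by rw [MonoidHom.ker_rangeRestrict]; exact hk) e e
  let h : 𝓕.S j →* (π k).range := (𝓕.f hkj).codRestrict _ fun y => hj ⟨y, rfl⟩
  have e' : 𝓕.f (hik.trans hkj) = ((𝓕.f hik).comp (π k).range.subtype).comp h := by
    ext y
    exact (𝓕.f_trans hik hkj y).symm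
  exact ⟨j, hik.trans hkj, by rw [e', M.pull_comp, key, map_zero, map_zero]⟩

/-- An element whose inflation is stable becomes stable at a finite stage. Otherwise the graphs of
the morphisms that witness the failure form an inverse system of non-empty finite sets, and a
compatible family of them yields a morphism of `F` that contradicts stability in the limit. -/
theorem exists_pull_mem_finStable {i : I} {x : M.val (𝓕.S i)}
    (hx : M.inflation (π i) (hF.isOpen_ker i) x ∈ M.stable F) :
    ∃ (j : I) (hij : i ≤ j), M.pull (𝓕.f hij) x ∈ M.finStable (𝓕.F j) := by
  have : Nonempty I := ⟨i⟩
  by_contra! hbad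
  -- At an index not above `i`, where `x` has no image, every graph is admitted.
  let Y : I → Type u := fun j => {Γ : Subgroup (𝓕.S j × 𝓕.S j) //
    (𝓕.F j).IsGraph Γ ∧ ∀ hij : i ≤ j, ¬ M.EqualizedOn (M.pull (𝓕.f hij) x) Γ}
  have hpull : ∀ {j k : I} (hij : i ≤ j) (hjk : j ≤ k),
      M.pull (𝓕.f hjk) (M.pull (𝓕.f hij) x) = M.pull (𝓕.f (hij.trans hjk)) x := by
    intro j k hij hjk
    rw [← M.pull_comp]
    congr 2
    ext y
    exact 𝓕.f_trans hij hjk y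
  let T : ∀ {j k : I}, j ≤ k → Y k → Y j := fun {j k} hjk Γ =>
    ⟨Γ.1.map ((𝓕.f hjk).prodMap (𝓕.f hjk)), (𝓕.isMorphism hjk).isGraph_map Γ.2.1,
      fun hij h => Γ.2.2 (hij.trans hjk) (by rw [← hpull hij hjk]; exact h.of_map)⟩
  have hfin : ∀ j, Finite (Y j) := fun j => by
    have := (𝓕.isFinPGroup j).finite
    exact Subtype.finite
  have hne : ∀ j, Nonempty (Y j) := fun j => by
    obtain ⟨k, hik, hjk⟩ := exists_ge_ge i j
    by_contra hemp
    refine hbad k hik (M.mem_finStable_of_equalizedOn fun Γ hΓ => ?_)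
    by_contra h
    exact hemp ⟨T hjk ⟨Γ, hΓ, fun _ => h⟩⟩
  obtain ⟨Γ, hΓ⟩ := exists_compatible_of_finite (X := Y) (fun hjk => T hjk)
    (fun j Γ => Subtype.ext (by
      have e : (𝓕.f (le_refl j)).prodMap (𝓕.f (le_refl j)) = MonoidHom.id _ := by
        ext z
        · exact 𝓕.f_refl j z.1
        · exact 𝓕.f_refl j z.2
      change Γ.1.map ((𝓕.f (le_refl j)).prodMap (𝓕.f (le_refl j))) = Γ.1
      rw [e, Subgroup.map_id]))
    (fun {j k l} hjk hkl Γ => Subtype.ext (by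
      change (Γ.1.map ((𝓕.f hkl).prodMap (𝓕.f hkl))).map ((𝓕.f hjk).prodMap (𝓕.f hjk)) =
        Γ.1.map ((𝓕.f (hjk.trans hkl)).prodMap (𝓕.f (hjk.trans hkl)))
      rw [Subgroup.map_map]
      congr 1
      ext z
      · exact 𝓕.f_trans hjk hkl z.1
      · exact 𝓕.f_trans hjk hkl z.2))
  obtain ⟨P, φ, hφ, hφΓ, hsurj⟩ := hF.exists_hom_of_isGraph (fun j => (Γ j).1)
    (fun j => (Γ j).2.1) (fun hjk => congrArg Subtype.val (hΓ hjk))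
  have hstab := hx P φ hφ
  have hopen : ∀ ψ : P →ₜ* S, IsOpen (((π i).comp ψ.toMonoidHom).ker : Set P) := fun ψ =>
    (hF.isOpen_ker i).preimage ψ.continuous_toFun
  rw [M.extPull_inflation _ _ _ (hopen _), M.extPull_inflation _ _ _ (hopen _)] at hstab
  obtain ⟨N, hN⟩ := M.exists_of_inflation_eq _ _ hstab
  obtain ⟨U, hU, hUN⟩ := isOpen_induced_iff.mp N.isOpen'
  have h1 : (1 : S) ∈ U := by
    have : (1 : P) ∈ (Subtype.val ⁻¹' U : Set P) := by
      rw [hUN]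
      exact N.one_mem'
    exact this
  obtain ⟨k, hik, hk⟩ := hF.exists_ker_subset i (hU.mem_nhds h1)
  -- `P` maps onto the graph at stage `k`, and the kernel of this map lies in `N`.
  let γ : P →* (Γ k).1 := (((π k).comp P.incl.toMonoidHom).prod
    ((π k).comp ((⊤ : ClosedSubgroup S).incl.comp φ).toMonoidHom)).codRestrict _ (hφΓ k)
  have hγ : Function.Surjective γ := fun z => by
    obtain ⟨y, hy⟩ := hsurj k z.1 z.2
    exact ⟨y, Subtype.ext hy⟩
  have hker : γ.ker ≤ N.toSubgroup := fun y hy => by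
    have hy1 : π k (y : S) = 1 := congrArg (fun z => z.1.1) (MonoidHom.mem_ker.mp hy)
    have : y ∈ (Subtype.val ⁻¹' U : Set P) := hk hy1
    rw [hUN] at this
    exact this
  have key := hN γ ((𝓕.f hik).comp ((MonoidHom.fst _ _).comp (Γ k).1.subtype))
    ((𝓕.f hik).comp ((MonoidHom.snd _ _).comp (Γ k).1.subtype)) hγ hker
    (by ext y; exact hF.compatible hik _) (by ext y; exact hF.compatible hik _)
  exact (Γ k).2.2 hik (((M.pull_comp (𝓕.f hik) _ x).symm.trans key).trans
    (M.pull_comp (𝓕.f hik) _ x))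

end ClosedSubgroupCategory.IsInverseLimit

/-- Inflation induces an isomorphism from the direct limit of the `M(S i)^{F i}` onto `M(S)^F`. -/
theorem theorem3p1 {p : ℕ} [Fact p.Prime] {R : Type v} [Ring R] (M : PGroupFunctor.{u, v, w} p R)
    {S : Type u} [Group S] [TopologicalSpace S] [IsProPGroup p S]
    {I : Type t} [Preorder I] [Nonempty I] [IsDirectedOrder I]
    (𝓕 : FusionInverseSystem.{u, t} p I) (π : ∀ i, S →* 𝓕.S i)
    (F : ClosedSubgroupCategory S) (hF : F.IsInverseLimit 𝓕 π)
    (hsat : F.IsProSaturated.{u, r, s} p) :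
    ∃ e : M.StableLimit 𝓕 ≃ₗ[R] M.stable F,
      ∀ (i : I) (x : M.finStable (𝓕.F i)),
        (e (M.toStableLimit 𝓕 i x) : M.ext S) = M.inflation (π i) (hF.isOpen_ker i) x := by
  classical
  let g : ∀ i, M.finStable (𝓕.F i) →ₗ[R] M.stable F := fun i =>
    (M.inflation (π i) (hF.isOpen_ker i)).restrict fun _ hx => hF.inflation_mem_stable M i hx
  let L : M.StableLimit 𝓕 →ₗ[R] M.stable F :=
    Module.DirectLimit.lift R I _ (M.stableTransition 𝓕) g fun i j hij x =>
      Subtype.ext (hF.inflation_pull_transition M hij x.1)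
  have hL : ∀ i x, (L (M.toStableLimit 𝓕 i x) : M.ext S) =
      M.inflation (π i) (hF.isOpen_ker i) x := fun i x =>
    congrArg Subtype.val (Module.DirectLimit.lift_of (f := M.stableTransition 𝓕) g _ x)
  have htrans : ∀ {i j : I} (hij : i ≤ j) (x : M.finStable (𝓕.F i)),
      M.toStableLimit 𝓕 j (M.stableTransition 𝓕 i j hij x) = M.toStableLimit 𝓕 i x :=
    fun hij x => Module.DirectLimit.of_f (f := M.stableTransition 𝓕) (hij := hij)
  refine ⟨LinearEquiv.ofBijective L ⟨(injective_iff_map_eq_zero L).mpr fun z hz => ?_,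
    fun y => ?_⟩, hL⟩
  · obtain ⟨i, x, hx⟩ := Module.DirectLimit.exists_of (f := M.stableTransition 𝓕) z
    change M.toStableLimit 𝓕 i x = z at hx
    subst hx
    obtain ⟨j, hij, h⟩ := hF.exists_pull_eq_zero M
      ((hL i x).symm.trans (congrArg Subtype.val hz))
    have h0 : M.stableTransition 𝓕 i j hij x = 0 := Subtype.ext h
    rw [← htrans hij, h0, map_zero]
  · obtain ⟨i, x, hx⟩ := hF.exists_inflation_eq M y.1
    obtain ⟨j, hij, h⟩ := hF.exists_pull_mem_finStable M (x := x) (by rw [hx]; exact y.2)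
    refine ⟨M.toStableLimit 𝓕 j ⟨_, h⟩, Subtype.ext ?_⟩
    rw [hL, hF.inflation_pull_transition, hx]
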